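/- Let $W=\{w_1,\dots,w_n\}$ be a set of women and $M=\{m_1,\dots,m_n\}$ a disjoint set of men. Every woman has a full preference list (a total ordering) over $M$ and every man has a full preference list over $W$; Alice holds the preference lists of all the women and Bob holds those of all the men. A perfect marriage is a bijection $\mu:W\to M$; it is stable if there is no pair $(w,m)\in W\times M$ such that $w$ prefers $m$ over $\mu(w)$ and $m$ prefers $w$ over $\mu^{-1}(m)$. A randomized two-party protocol (with shared random coins, which includes protocols with private coins) finds a stable marriage with success probability $p$ if for every fixed choice of the preference lists its output, which is determined by the coins and the bits exchanged, is a stable marriage with probability at least $p$. Its communication cost is the number of bits that Alice and Bob exchange in the worst case over all inputs and coins, and the randomized communication complexity $R_p(n)$ is the lowest communication cost of any such protocol. Then $R_{2/3}(n)=\Omega(n^2)$. More generally, for every fixed $p$ with $\frac12<p\le1$ there are $c>0$ and $N$, depending only on $p$, such that $R_p(n)\ge c\,n^2$ for all $n\ge N$. -/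

import Mathlib

open scoped ENNReal

namespace StableMarriage

/-! ### Marriage markets with full preference lists -/

/-- A full preference list over `A`: a (strict) total ordering of `A`, best first. -/
structure PrefList (A : Type*) where
  /-- `prefers a b`: the element `a` precedes the element `b` on the list. -/
  prefers : A → A → Prop
  isStrictTotalOrder : IsStrictTotalOrder A prefers

/-- A profile of full preference lists for `A` over `B`: one list over `B` for every `a : A`. -/
abbrev Profile (A B : Type*) := A → PrefList B

/-- A perfect marriage between `W` and `M`: a one-to-one mapping between the two sets. -/
abbrev PerfectMarriage (W M : Type*) := W ≃ M

/-- `(w, m)` is a blocking pair with respect to `μ`: each of `w` and `m` prefers the other over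
the own spouse in `μ`. -/
def IsBlockingPair {W M : Type*} (PW : Profile W M) (PM : Profile M W)
    (μ : PerfectMarriage W M) (w : W) (m : M) : Prop :=
  (PW w).prefers m (μ w) ∧ (PM m).prefers w (μ.symm m)

/-- `μ` is stable: it has no blocking pair. -/
def IsStable {W M : Type*} (PW : Profile W M) (PM : Profile M W)
    (μ : PerfectMarriage W M) : Prop :=
  ∀ (w : W) (m : M), ¬ IsBlockingPair PW PM μ w m

/-! ### Two-party communication complexity -/

/-- A deterministic two-party protocol tree. Alice holds an input in `X`, Bob holds an input
in `Y`. At an inner node one of the two sends a bit that depends on the own input (and on the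
node, that is, on the bits exchanged so far); a leaf carries the output in `Z`. -/
inductive Protocol (X Y Z : Type*) where
  | output (z : Z) : Protocol X Y Z
  | alice (bit : X → Bool) (next : Bool → Protocol X Y Z) : Protocol X Y Z
  | bob (bit : Y → Bool) (next : Bool → Protocol X Y Z) : Protocol X Y Z

namespace Protocol

variable {X Y Z : Type*}

/-- The output of the protocol on the input `(x, y)`. -/
def run : Protocol X Y Z → X → Y → Z
  | output z, _, _ => z
  | alice bit next, x, y => (next (bit x)).run x y
  | bob bit next, x, y => (next (bit y)).run x y

/-- The number of bits exchanged by the protocol on the input `(x, y)`. -/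
def bits : Protocol X Y Z → X → Y → ℕ
  | output _, _, _ => 0
  | alice bit next, x, y => (next (bit x)).bits x y + 1
  | bob bit next, x, y => (next (bit y)).bits x y + 1

end Protocol

/-- A randomized (public-coin) protocol: a probability distribution over deterministic protocols.
Private coins are the special case in which the shared random string consists of two independent
parts, one of which is used by Alice only and the other by Bob only. -/
abbrev RandProtocol (X Y Z : Type*) := PMF (Protocol X Y Z)

namespace RandProtocol

variable {X Y Z : Type*}

/-- On every fixed input `(x, y)`, the output `z` is correct, in the sense that `R x y z` holds,
with probability at least `p`. -/
def Computes (P : RandProtocol X Y Z) (R : X → Y → Z → Prop) (p : ℝ) : Prop :=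
  ∀ (x : X) (y : Y), ENNReal.ofReal p ≤ P.toOuterMeasure {π | R x y (π.run x y)}

/-- The communication cost: the number of bits exchanged in the worst case. -/
noncomputable def cost (P : RandProtocol X Y Z) : ℕ∞ :=
  ⨆ π ∈ P.support, ⨆ (x : X) (y : Y), (π.bits x y : ℕ∞)

end RandProtocol

/-- The randomized communication complexity, with success probability `p`, of the search problem
`R`: the lowest cost of any randomized protocol for it. -/
noncomputable def randCC {X Y Z : Type*} (R : X → Y → Z → Prop) (p : ℝ) : ℕ∞ :=
  ⨅ (P : RandProtocol X Y Z) (_ : P.Computes R p), P.cost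

/-- The randomized communication complexity of finding a stable marriage between `n` women and
`n` men, where Alice holds the profile of the women and Bob holds the profile of the men. -/
noncomputable def stableMarriageCC (p : ℝ) (n : ℕ) : ℕ∞ :=
  randCC (X := Profile (Fin n) (Fin n)) (Y := Profile (Fin n) (Fin n))
    (Z := PerfectMarriage (Fin n) (Fin n)) (fun PW PM μ => IsStable PW PM μ) p

end StableMarriage

/-! The bound is a reduction from set disjointness on the pairs `(a, b)` with `a` in one half `I` of
the indices and `b` in the other, about `n ^ 2 / 4` points. Alice's set decides which men a woman
ranks above her namesake, and Bob's set does the same for the men. If the sets are disjoint, the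
identity is the only stable marriage (`eq_refl_of_isStable`). If they meet, a common point blocks it
(`not_isStable_refl`). Hence asking whether the output is the identity decides disjointness.

Disjointness is hard already against a single common point. A random mask `d` gives each coordinate
to one player and random bits `z` fill it, so `d ⊓ z` and `dᶜ ⊓ z` are disjoint. Each leaf of a
protocol is a rectangle, hence a `[0, 1]`-valued function of `z`. The level-one inequality bounds
its total sensitivity to single coordinates by the entropy term of its mass, and over all leaves
these terms add up to at most the log of the number of leaves, so at most the cost. Thus for a
typical coordinate `i` the leaf distribution hardly changes, in Hellinger distance, when one
player's bit at `i` is set. `cut_and_paste` carries this over to setting both bits. An averaging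
over the coins (`RandProtocol.le_of_computes`) passes to randomized protocols. -/

open Finset Function
open scoped BigOperators

namespace StableMarriage

/-! ### The level-one inequality on the discrete cube -/

section Cube

variable {ι : Type*} [Fintype ι] [DecidableEq ι]

/-- The `±1`-valued character of a bit. -/
def bitSign (b : Bool) : ℝ := if b then 1 else -1

theorem expect_flip (i : ι) (h : (ι → Bool) → ℝ) :
    𝔼 z, h (update z i (!z i)) = 𝔼 z, h z := by
  refine Fintype.expect_equiv
    (Function.Involutive.toPerm (fun z : ι → Bool => update z i (!z i)) fun z => ?_) _ _ fun z => rfl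
  simp

theorem expect_split (i : ι) (h : (ι → Bool) → ℝ) :
    𝔼 z, h z = ((𝔼 z, h (update z i true)) + 𝔼 z, h (update z i false)) / 2 := by
  have key : ∀ z : ι → Bool,
      h (update z i true) + h (update z i false) = h z + h (update z i (!z i)) := by
    intro z
    have hz : h z = h (update z i (z i)) := by rw [update_eq_self]
    rw [hz]
    cases z i <;> simp [add_comm]
  rw [← expect_add_distrib, expect_congr rfl fun z _ => key z, expect_add_distrib, expect_flip]
  ring

theorem expect_exp_sum_bitSign (c : ι → ℝ) :
    𝔼 z : ι → Bool, Real.exp (∑ i, c i * bitSign (z i)) = ∏ i, Real.cosh (c i) := by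
  have h1 : ∏ i, Real.cosh (c i) = ∏ i, ∑ b : Bool, Real.exp (c i * bitSign b) / 2 := by
    refine prod_congr rfl fun i _ => ?_
    rw [Fintype.sum_bool, Real.cosh_eq]
    simp [bitSign]
    ring
  rw [h1, prod_univ_sum, Fintype.piFinset_univ, Fintype.expect_eq_sum_div_card, sum_div]
  refine sum_congr rfl fun z _ => ?_
  rw [prod_div_distrib, Real.exp_sum]
  simp

/-- Exponential tilting: with `f` the normalised linear part of `F`, the mean of `F * exp f` is at
least `q * exp m` by the tangent to `exp` at `m`, and at most the mean of `exp f`, a product of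
`cosh` values bounded by `exp (m / 2)`. -/
theorem level_one {F : (ι → Bool) → ℝ} (h0 : ∀ z, 0 ≤ F z) (h1 : ∀ z, F z ≤ 1)
    (hq : 0 < 𝔼 z, F z) :
    (∑ i, (𝔼 z, F z * bitSign (z i)) ^ 2) / (𝔼 z, F z) ≤ 2 * Real.negMulLog (𝔼 z, F z) := by
  set q := 𝔼 z, F z with hqdef
  set s : ι → ℝ := fun i => 𝔼 z, F z * bitSign (z i) with hs
  set m := ∑ i, (s i / q) ^ 2 with hm
  let f : (ι → Bool) → ℝ := fun z => ∑ i, s i / q * bitSign (z i)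
  have hFf : 𝔼 z, F z * f z = q * m := by
    have : ∀ z, F z * f z = ∑ i, s i / q * (F z * bitSign (z i)) := fun z => by
      simp only [f, mul_sum]
      exact sum_congr rfl fun i _ => by ring
    rw [expect_congr rfl fun z _ => this z, expect_sum_comm, hm, mul_sum]
    refine sum_congr rfl fun i _ => ?_
    rw [← mul_expect]
    change s i / q * s i = _
    field_simp
  have hlow : Real.exp m * q ≤ 𝔼 z, F z * Real.exp (f z) := by
    have e1 : Real.exp m * q = 𝔼 z, Real.exp m * (F z + F z * f z - m * F z) := by
      rw [← mul_expect, expect_sub_distrib, expect_add_distrib, ← mul_expect, hFf]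
      ring
    rw [e1]
    refine expect_le_expect fun z _ => ?_
    have e2 : Real.exp (f z) = Real.exp m * Real.exp (f z - m) := by
      rw [← Real.exp_add]; congr 1; ring
    rw [e2]
    have e3 := mul_le_mul_of_nonneg_left (Real.add_one_le_exp (f z - m))
      (mul_nonneg (h0 z) (Real.exp_pos m).le)
    linarith
  have hup : 𝔼 z, F z * Real.exp (f z) ≤ Real.exp (m / 2) := by
    calc 𝔼 z, F z * Real.exp (f z) ≤ 𝔼 z, Real.exp (f z) :=
          expect_le_expect fun z _ => mul_le_of_le_one_left (Real.exp_pos _).le (h1 z)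
      _ = ∏ i, Real.cosh (s i / q) := expect_exp_sum_bitSign _
      _ ≤ ∏ i, Real.exp ((s i / q) ^ 2 / 2) :=
          prod_le_prod (fun i _ => (Real.cosh_pos _).le) fun i _ => Real.cosh_le_exp_half_sq _
      _ = Real.exp (m / 2) := by rw [← Real.exp_sum, hm, sum_div]
  have hlog : m ≤ -2 * Real.log q := by
    have := Real.log_le_log (mul_pos (Real.exp_pos m) hq) (hlow.trans hup)
    rw [Real.log_mul (Real.exp_pos _).ne' hq.ne', Real.log_exp, Real.log_exp] at this
    linarith
  have hms : (∑ i, s i ^ 2) / q = q * m := by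
    rw [hm, mul_sum, sum_div]
    exact sum_congr rfl fun i _ => by field_simp
  rw [hms, Real.negMulLog]
  nlinarith

theorem sq_sqrt_sub_sqrt_le {u v : ℝ} (hu : 0 ≤ u) (hv : 0 ≤ v) (huv : 0 < u + v) :
    (√u - √v) ^ 2 ≤ (u - v) ^ 2 / (u + v) := by
  rw [le_div_iff₀ huv]
  have e : (u - v) ^ 2 = (√u - √v) ^ 2 * (√u + √v) ^ 2 := by
    rw [← mul_pow]
    congr 1
    nlinarith [Real.sq_sqrt hu, Real.sq_sqrt hv]
  rw [e]
  refine mul_le_mul_of_nonneg_left ?_ (sq_nonneg _)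
  nlinarith [Real.sq_sqrt hu, Real.sq_sqrt hv, mul_nonneg (Real.sqrt_nonneg u) (Real.sqrt_nonneg v)]

/-- The level-one inequality in terms of squared Hellinger distances. -/
theorem sum_sq_sqrt_sub_sqrt_le {F : (ι → Bool) → ℝ} (h0 : ∀ z, 0 ≤ F z) (h1 : ∀ z, F z ≤ 1) :
    ∑ i, (√(𝔼 z, F (update z i false)) - √(𝔼 z, F (update z i true))) ^ 2 ≤
      4 * Real.negMulLog (𝔼 z, F z) := by
  have hnn : ∀ (i : ι) (b : Bool), 0 ≤ 𝔼 z, F (update z i b) :=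
    fun i b => expect_nonneg fun z _ => h0 _
  rcases (expect_nonneg fun z _ => h0 z : 0 ≤ 𝔼 z, F z).eq_or_lt with hq | hq
  · rw [← hq, Real.negMulLog_zero, mul_zero]
    refine (sum_eq_zero fun i _ => ?_).le
    have := expect_split i F
    have h2 := hnn i true
    have h3 := hnn i false
    rw [show 𝔼 z, F (update z i true) = 0 by linarith,
      show 𝔼 z, F (update z i false) = 0 by linarith]
    simp
  · have hl := level_one h0 h1 hq
    calc _ ≤ ∑ i, 2 * ((𝔼 z, F z * bitSign (z i)) ^ 2 / (𝔼 z, F z)) := ?_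
      _ = 2 * ((∑ i, (𝔼 z, F z * bitSign (z i)) ^ 2) / (𝔼 z, F z)) := by
          rw [sum_div, mul_sum]
      _ ≤ _ := by linarith
    refine sum_le_sum fun i _ => ?_
    have e1 := expect_split i F
    have e2 := expect_split i fun z => F z * bitSign (z i)
    have ht : 𝔼 z : ι → Bool, F (update z i true) * bitSign (update z i true i) =
        𝔼 z, F (update z i true) := by simp [bitSign]
    have hf : 𝔼 z : ι → Bool, F (update z i false) * bitSign (update z i false i) =
        -𝔼 z, F (update z i false) := by simp [bitSign]
    rw [ht, hf] at e2
    -- The two conditional means differ by twice the level-one coefficient and sum to twice the mean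
    -- of `F`, so the bound equals `2 * s ^ 2 / q`.
    refine (sq_sqrt_sub_sqrt_le (hnn i false) (hnn i true) (by linarith)).trans (le_of_eq ?_)
    rw [e2, e1]
    have : (𝔼 z, F (update z i true)) + 𝔼 z, F (update z i false) ≠ 0 := by linarith
    rw [add_comm (𝔼 z, F (update z i false))]
    field_simp
    ring

end Cube

/-- The uniform distribution maximises entropy; termwise this is `log t ≤ t - 1` at `t = 1 / (q l *
card L)`. -/
theorem sum_negMulLog_le {L : Type*} [Fintype L] [Nonempty L] {q : L → ℝ} (h0 : ∀ l, 0 ≤ q l)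
    (h1 : ∑ l, q l = 1) : ∑ l, Real.negMulLog (q l) ≤ Real.log (Fintype.card L) := by
  have hc : (0 : ℝ) < Fintype.card L := by exact_mod_cast Fintype.card_pos
  have key : ∀ l, Real.negMulLog (q l) ≤
      q l * Real.log (Fintype.card L) + ((Fintype.card L : ℝ)⁻¹ - q l) := by
    intro l
    rcases (h0 l).eq_or_lt with h | h
    · rw [← h]; simp
    · have := Real.log_le_sub_one_of_pos (inv_pos.2 (mul_pos h hc))
      rw [Real.log_inv, Real.log_mul h.ne' hc.ne'] at this
      have := mul_le_mul_of_nonneg_left this h.le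
      have e : q l * ((q l * (Fintype.card L : ℝ))⁻¹ - 1) = (Fintype.card L : ℝ)⁻¹ - q l := by
        field_simp
      rw [e] at this
      rw [Real.negMulLog]
      linarith
  refine (sum_le_sum fun l _ => key l).trans (le_of_eq ?_)
  rw [sum_add_distrib, ← sum_mul, sum_sub_distrib, h1]
  simp

/-! ### Cut and paste -/

/-- The product form makes the Hellinger distance between inputs `00` and `11` equal to that between
`10` and `01`, which passes through `00`. The constant 8 is 4 from Cauchy–Schwarz times 2 from the
squared triangle inequality. -/
theorem cut_and_paste {L : Type*} [Fintype L] {A B : L → Bool → ℝ} (hA : ∀ l u, 0 ≤ A l u)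
    (hB : ∀ l u, 0 ≤ B l u) (h1 : ∀ u v, ∑ l, A l u * B l v = 1) (S : Finset L) :
    (∑ l ∈ S, (A l false * B l false - A l true * B l true)) ^ 2 ≤
      8 * ∑ l, ((√(A l false * B l false) - √(A l true * B l false)) ^ 2 +
        (√(A l false * B l false) - √(A l false * B l true)) ^ 2) := by
  have hs : ∀ l u v, √(A l u * B l v) ^ 2 = A l u * B l v :=
    fun l u v => Real.sq_sqrt (mul_nonneg (hA l u) (hB l v))
  have hdiag : ∑ l, (√(A l false * B l false) - √(A l true * B l true)) ^ 2 =
      ∑ l, (√(A l true * B l false) - √(A l false * B l true)) ^ 2 := by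
    have e : ∀ l, (√(A l false * B l false) - √(A l true * B l true)) ^ 2 -
        (√(A l true * B l false) - √(A l false * B l true)) ^ 2 =
        A l false * B l false + A l true * B l true - A l true * B l false
          - A l false * B l true := by
      intro l
      have e1 : √(A l false * B l false) * √(A l true * B l true) =
          √(A l true * B l false) * √(A l false * B l true) := by
        rw [← Real.sqrt_mul (mul_nonneg (hA _ _) (hB _ _)),
          ← Real.sqrt_mul (mul_nonneg (hA _ _) (hB _ _))]
        congr 1
        ring
      linear_combination hs l false false + hs l true true - hs l true false - hs l false true
        - 2 * e1
    have e2 := sum_congr (rfl : (univ : Finset L) = univ) fun l _ => e l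
    rw [sum_sub_distrib, sum_sub_distrib, sum_sub_distrib, sum_add_distrib, h1, h1, h1, h1] at e2
    linarith
  have hcs : (∑ l ∈ S, (A l false * B l false - A l true * B l true)) ^ 2 ≤
      (∑ l, (√(A l false * B l false) - √(A l true * B l true)) ^ 2) * 4 := by
    calc (∑ l ∈ S, (A l false * B l false - A l true * B l true)) ^ 2
        = (∑ l ∈ S, (√(A l false * B l false) - √(A l true * B l true)) *
            (√(A l false * B l false) + √(A l true * B l true))) ^ 2 := by
          congr 1
          refine sum_congr rfl fun l _ => ?_
          linear_combination -hs l false false + hs l true true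
      _ ≤ (∑ l ∈ S, (√(A l false * B l false) - √(A l true * B l true)) ^ 2) *
            ∑ l ∈ S, (√(A l false * B l false) + √(A l true * B l true)) ^ 2 :=
          sum_mul_sq_le_sq_mul_sq _ _ _
      _ ≤ (∑ l, (√(A l false * B l false) - √(A l true * B l true)) ^ 2) *
            ∑ l, (√(A l false * B l false) + √(A l true * B l true)) ^ 2 := by
          refine mul_le_mul ?_ ?_ (sum_nonneg fun _ _ => sq_nonneg _)
            (sum_nonneg fun _ _ => sq_nonneg _) <;>
          exact sum_le_sum_of_subset_of_nonneg (subset_univ _) fun _ _ _ => sq_nonneg _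
      _ ≤ _ := by
          refine mul_le_mul_of_nonneg_left ?_ (sum_nonneg fun _ _ => sq_nonneg _)
          calc _ ≤ ∑ l, 2 * (A l false * B l false + A l true * B l true) := by
                refine sum_le_sum fun l _ => ?_
                nlinarith [hs l false false, hs l true true,
                  sq_nonneg (√(A l false * B l false) - √(A l true * B l true))]
            _ = 4 := by rw [← mul_sum, sum_add_distrib, h1, h1]; norm_num
  refine hcs.trans ?_
  rw [hdiag, sum_mul, mul_sum]
  refine sum_le_sum fun l _ => ?_
  nlinarith [sq_nonneg ((√(A l false * B l false) - √(A l true * B l false)) +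
    (√(A l false * B l false) - √(A l false * B l true)))]

/-! ### Rectangle partitions and disjointness -/

theorem inf_update {ι : Type*} [DecidableEq ι] (d z : ι → Bool) (i : ι) (v : Bool) :
    d ⊓ update z i v = update (d ⊓ z) i (d i && v) := by
  ext j
  by_cases h : j = i
  · subst h; simp
  · simp [h]

theorem update_flip_inf {ι : Type*} [DecidableEq ι] (d z : ι → Bool) (i : ι) (v w : Bool) :
    update (update d i w ⊓ z) i v = update (d ⊓ z) i v := by
  ext j
  by_cases h : j = i
  · subst h; simp
  · simp [h]

theorem compl_update_bool {ι : Type*} [DecidableEq ι] (d : ι → Bool) (i : ι) (w : Bool) :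
    (update d i w)ᶜ = update dᶜ i (!w) := by
  ext j
  by_cases h : j = i
  · subst h; simp
  · simp [h]

section Disjointness

variable {ι : Type*} [Fintype ι] [DecidableEq ι]

/-- The two factors read disjoint sets of coordinates, hence are independent: swapping the
coordinates outside `d` between two copies of the cube merges them into one. -/
theorem expect_mul_of_mask (d : ι → Bool) (f g : (ι → Bool) → ℝ) :
    𝔼 z, f (d ⊓ z) * g (dᶜ ⊓ z) = (𝔼 z, f (d ⊓ z)) * 𝔼 z, g (dᶜ ⊓ z) := by
  let mix : (ι → Bool) × (ι → Bool) → (ι → Bool) × (ι → Bool) :=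
    fun w => (fun i => if d i then w.1 i else w.2 i, fun i => if d i then w.2 i else w.1 i)
  have hmix : Involutive mix := by
    rintro ⟨z, w⟩
    ext i <;> by_cases h : d i <;> simp [mix, h]
  have h1 : 𝔼 w : (ι → Bool) × (ι → Bool), f (d ⊓ w.1) * g (dᶜ ⊓ w.2) =
      𝔼 w : (ι → Bool) × (ι → Bool), f (d ⊓ w.1) * g (dᶜ ⊓ w.1) := by
    refine Fintype.expect_equiv hmix.toPerm _ _ fun w => ?_
    have e1 : d ⊓ w.1 = d ⊓ (mix w).1 := by
      ext i; by_cases h : d i <;> simp [mix, h]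
    have e2 : dᶜ ⊓ w.2 = dᶜ ⊓ (mix w).1 := by
      ext i; by_cases h : d i <;> simp [mix, h]
    rw [e1, e2]
    rfl
  rw [expect_mul_expect]
  rw [← univ_product_univ, expect_product, expect_product] at h1
  rw [h1]
  simp

/-- The average advantage of a function that is a union of rectangles of a partition into few
rectangles, on disjoint pairs versus pairs that intersect in a single point. -/
theorem expect_sum_sq_advantage_le {L : Type*} [Fintype L] {a b : L → (ι → Bool) → ℝ}
    (ha : ∀ l x, 0 ≤ a l x) (hb : ∀ l y, 0 ≤ b l y) (h1 : ∀ x y, ∑ l, a l x * b l y = 1)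
    (S : Finset L) :
    𝔼 d : ι → Bool, ∑ i, (𝔼 z : ι → Bool,
        ((∑ l ∈ S, a l (update (d ⊓ z) i false) * b l (update (dᶜ ⊓ z) i false)) -
          ∑ l ∈ S, a l (update (d ⊓ z) i true) * b l (update (dᶜ ⊓ z) i true))) ^ 2 ≤
      64 * Real.log (Fintype.card L) := by
  have hL : Nonempty L := by
    by_contra h
    rw [not_nonempty_iff] at h
    simpa using h1 (fun _ => false) (fun _ => false)
  let A : (ι → Bool) → ι → L → Bool → ℝ := fun d i l u => 𝔼 z, a l (update (d ⊓ z) i u)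
  let B : (ι → Bool) → ι → L → Bool → ℝ := fun d i l v => 𝔼 z, b l (update (dᶜ ⊓ z) i v)
  have hA : ∀ d i l u, 0 ≤ A d i l u := fun d i l u => expect_nonneg fun _ _ => ha _ _
  have hB : ∀ d i l u, 0 ≤ B d i l u := fun d i l u => expect_nonneg fun _ _ => hb _ _
  have hAB : ∀ d i l u v, A d i l u * B d i l v =
      𝔼 z, a l (update (d ⊓ z) i u) * b l (update (dᶜ ⊓ z) i v) := fun d i l u v =>
    (expect_mul_of_mask d (fun x => a l (update x i u)) (fun y => b l (update y i v))).symm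
  have hAB1 : ∀ d i u v, ∑ l, A d i l u * B d i l v = 1 := by
    intro d i u v
    simp_rw [hAB]
    rw [← expect_sum_comm]
    simp [h1]
  -- `A` and `B` overwrite coordinate `i`, so they do not depend on who owns it. Averaging over `d`
  -- thus combines the case where Alice's bit changes with the one where Bob's does.
  let flip : ι → (ι → Bool) → ι → Bool := fun i d => update d i (!d i)
  have hAf : ∀ d i l u, A (flip i d) i l u = A d i l u := by
    intro d i l u; simp only [A, flip, update_flip_inf]
  have hBf : ∀ d i l u, B (flip i d) i l u = B d i l u := by
    intro d i l u; simp only [B, flip, compl_update_bool, update_flip_inf]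
  -- Squared Hellinger distance from `00` to `10` if Alice owns `i`, and to `01` if Bob does.
  let h : (ι → Bool) → ι → ℝ := fun d i => ∑ l, (√(A d i l false * B d i l false) -
    √(A d i l (d i) * B d i l (!d i))) ^ 2
  have hone : ∀ d, ∑ i, h d i ≤ 4 * Real.log (Fintype.card L) := by
    intro d
    let F : L → (ι → Bool) → ℝ := fun l z => a l (d ⊓ z) * b l (dᶜ ⊓ z)
    have hF0 : ∀ l z, 0 ≤ F l z := fun l z => mul_nonneg (ha _ _) (hb _ _)
    have hF1 : ∀ l z, F l z ≤ 1 := fun l z => by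
      rw [← h1 (d ⊓ z) (dᶜ ⊓ z)]
      exact single_le_sum (f := fun l => a l (d ⊓ z) * b l (dᶜ ⊓ z)) (fun l _ => hF0 l z)
        (mem_univ l)
    have hq : ∑ l, 𝔼 z, F l z = 1 := by
      rw [← expect_sum_comm]
      simp [F, h1]
    have hF : ∀ l i v, 𝔼 z, F l (update z i v) = A d i l (d i && v) * B d i l (!d i && v) := by
      intro l i v
      rw [hAB]
      simp only [F, inf_update, Pi.compl_apply]
      rfl
    calc ∑ i, h d i
        = ∑ l, ∑ i, (√(𝔼 z, F l (update z i false)) - √(𝔼 z, F l (update z i true))) ^ 2 := by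
          rw [sum_comm]
          simp only [hF, Bool.and_false, Bool.and_true]
      _ ≤ ∑ l, 4 * Real.negMulLog (𝔼 z, F l z) :=
          sum_le_sum fun l _ => sum_sq_sqrt_sub_sqrt_le (hF0 l) (hF1 l)
      _ ≤ _ := by
          rw [← mul_sum]
          exact mul_le_mul_of_nonneg_left
            (sum_negMulLog_le (fun l => expect_nonneg fun z _ => hF0 l z) hq) (by norm_num)
  have hG : ∀ d i, (𝔼 z : ι → Bool,
        ((∑ l ∈ S, a l (update (d ⊓ z) i false) * b l (update (dᶜ ⊓ z) i false)) -
          ∑ l ∈ S, a l (update (d ⊓ z) i true) * b l (update (dᶜ ⊓ z) i true))) ^ 2 ≤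
      8 * (h d i + h (flip i d) i) := by
    intro d i
    have e1 : 𝔼 z : ι → Bool,
        ((∑ l ∈ S, a l (update (d ⊓ z) i false) * b l (update (dᶜ ⊓ z) i false)) -
          ∑ l ∈ S, a l (update (d ⊓ z) i true) * b l (update (dᶜ ⊓ z) i true)) =
        ∑ l ∈ S, (A d i l false * B d i l false - A d i l true * B d i l true) := by
      simp_rw [hAB, ← expect_sub_distrib]
      rw [← expect_sum_comm]
      simp_rw [sum_sub_distrib]
    have e2 : h d i + h (flip i d) i =
        ∑ l, ((√(A d i l false * B d i l false) - √(A d i l true * B d i l false)) ^ 2 +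
        (√(A d i l false * B d i l false) - √(A d i l false * B d i l true)) ^ 2) := by
      have hf : flip i d i = !d i := by simp [flip]
      simp only [h, hAf, hBf, hf, ← sum_add_distrib]
      refine sum_congr rfl fun l _ => ?_
      cases d i <;> simp [add_comm]
    rw [e1, e2]
    exact cut_and_paste (hA d i) (hB d i) (hAB1 d i) S
  calc _ ≤ 𝔼 d, ∑ i, 8 * (h d i + h (flip i d) i) :=
        expect_le_expect fun d _ => sum_le_sum fun i _ => hG d i
    _ = 16 * 𝔼 d, ∑ i, h d i := by
        rw [expect_sum_comm, expect_sum_comm, mul_sum]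
        refine sum_congr rfl fun i _ => ?_
        rw [← mul_expect, expect_add_distrib, expect_flip i fun d => h d i]
        ring
    _ ≤ 16 * (4 * Real.log (Fintype.card L)) := by
        refine mul_le_mul_of_nonneg_left ?_ (by norm_num)
        exact expect_le univ_nonempty fun d _ => hone d
    _ = _ := by ring

end Disjointness

/-! ### The rectangles of a protocol -/

/-- The sets `U` and `V` hold the inputs that reach the current node; the cost bound says nothing
about branches that no input reaches. `S` collects the leaves with output in `T`. -/
theorem Protocol.exists_rectangles {X Y Z : Type*} (T : Set Z) [DecidablePred (· ∈ T)]
    (π : Protocol X Y Z) (U : Set X) (V : Set Y) (C : ℕ)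
    (hC : ∀ x ∈ U, ∀ y ∈ V, π.bits x y ≤ C) :
    ∃ (L : Type) (_ : Fintype L) (a : L → X → ℝ) (b : L → Y → ℝ) (S : Finset L),
      Fintype.card L ≤ 2 ^ C ∧ (∀ l x, 0 ≤ a l x) ∧ (∀ l y, 0 ≤ b l y) ∧
      ∀ x ∈ U, ∀ y ∈ V, ∑ l, a l x * b l y = 1 ∧
        ∑ l ∈ S, a l x * b l y = if π.run x y ∈ T then 1 else 0 := by
  induction π generalizing U V C with
  | output z =>
    refine ⟨Unit, inferInstance, fun _ _ => 1, fun _ _ => 1, if z ∈ T then univ else ∅,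
      by simpa using Nat.one_le_two_pow, fun _ _ => zero_le_one, fun _ _ => zero_le_one,
      fun x _ y _ => ⟨by simp, ?_⟩⟩
    by_cases h : z ∈ T <;> simp [Protocol.run, h]
  | alice bit next ih =>
    cases C with
    | zero =>
      -- With no bits left at an inner node, no input pair can reach it, so the claim is vacuous.
      exact ⟨Empty, inferInstance, fun _ _ => 0, fun _ _ => 0, ∅, by simp, by simp, by simp,
        fun x hx y hy => absurd (hC x hx y hy) (by simp [Protocol.bits])⟩
    | succ C =>
      have := fun c => ih c {x ∈ U | bit x = c} V C fun x hx y hy => by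
        have := hC x hx.1 y hy
        simpa [Protocol.bits, hx.2] using this
      choose L hL a b S hcard ha hb hab using this
      refine ⟨L false ⊕ L true, inferInstance,
        Sum.elim (fun l x => if bit x = false then a false l x else 0)
          (fun l x => if bit x = true then a true l x else 0),
        Sum.elim (b false) (b true), (S false).disjSum (S true), ?_, ?_, ?_, ?_⟩
      · have h0 := hcard false
        have h1 := hcard true
        rw [Fintype.card_sum, pow_succ]
        omega
      · rintro (l | l) x <;> simp only [Sum.elim_inl, Sum.elim_inr] <;> split_ifs <;>
          first | exact le_rfl | exact ha _ _ _
      · rintro (l | l) y <;> exact hb _ _ _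
      · intro x hx y hy
        simp only [Fintype.sum_sum_type, sum_disjSum, Sum.elim_inl, Sum.elim_inr, Protocol.run]
        rcases Bool.eq_false_or_eq_true (bit x) with hbx | hbx <;> simp only [hbx] <;>
          simpa using hab _ x ⟨hx, hbx⟩ y hy
  | bob bit next ih =>
    cases C with
    | zero =>
      exact ⟨Empty, inferInstance, fun _ _ => 0, fun _ _ => 0, ∅, by simp, by simp, by simp,
        fun x hx y hy => absurd (hC x hx y hy) (by simp [Protocol.bits])⟩
    | succ C =>
      have := fun c => ih c U {y ∈ V | bit y = c} C fun x hx y hy => by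
        have := hC x hx y hy.1
        simpa [Protocol.bits, hy.2] using this
      choose L hL a b S hcard ha hb hab using this
      refine ⟨L false ⊕ L true, inferInstance, Sum.elim (a false) (a true),
        Sum.elim (fun l y => if bit y = false then b false l y else 0)
          (fun l y => if bit y = true then b true l y else 0),
        (S false).disjSum (S true), ?_, ?_, ?_, ?_⟩
      · have h0 := hcard false
        have h1 := hcard true
        rw [Fintype.card_sum, pow_succ]
        omega
      · rintro (l | l) x <;> exact ha _ _ _
      · rintro (l | l) y <;> simp only [Sum.elim_inl, Sum.elim_inr] <;> split_ifs <;>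
          first | exact le_rfl | exact hb _ _ _
      · intro x hx y hy
        simp only [Fintype.sum_sum_type, sum_disjSum, Sum.elim_inl, Sum.elim_inr, Protocol.run]
        rcases Bool.eq_false_or_eq_true (bit y) with hby | hby <;> simp only [hby] <;>
          simpa using hab _ x hx y ⟨hy, hby⟩

/-- A deterministic protocol of low cost cannot tell disjoint sets from sets that intersect in a
single point. -/
theorem Protocol.sq_expect_advantage_le {X Y Z ι : Type*} [Fintype ι] [DecidableEq ι] [Nonempty ι]
    (T : Set Z) [DecidablePred (· ∈ T)] (π : Protocol X Y Z) (f : (ι → Bool) → X)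
    (g : (ι → Bool) → Y) (C : ℕ) (hC : ∀ x y, π.bits x y ≤ C) :
    (𝔼 d : ι → Bool, 𝔼 i : ι, 𝔼 z : ι → Bool,
      ((if π.run (f (update (d ⊓ z) i false)) (g (update (dᶜ ⊓ z) i false)) ∈ T
          then (1 : ℝ) else 0) -
        if π.run (f (update (d ⊓ z) i true)) (g (update (dᶜ ⊓ z) i true)) ∈ T
          then 1 else 0)) ^ 2 * Fintype.card ι ≤ 64 * C := by
  obtain ⟨L, hL, a, b, S, hcard, ha, hb, hab⟩ :=
    π.exists_rectangles T Set.univ Set.univ C fun x _ y _ => hC x y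
  have hmain := expect_sum_sq_advantage_le (ι := ι) (a := fun l x => a l (f x))
    (b := fun l y => b l (g y)) (fun l x => ha _ _) (fun l y => hb _ _)
    (fun x y => (hab (f x) trivial (g y) trivial).1) S
  simp only [fun x y => (hab x trivial y trivial).2] at hmain
  set G : (ι → Bool) → ι → ℝ := fun d i => 𝔼 z : ι → Bool,
      ((if π.run (f (update (d ⊓ z) i false)) (g (update (dᶜ ⊓ z) i false)) ∈ T
          then (1 : ℝ) else 0) -
        if π.run (f (update (d ⊓ z) i true)) (g (update (dᶜ ⊓ z) i true)) ∈ T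
          then 1 else 0) with hGdef
  have hlog : Real.log (Fintype.card L) ≤ C := by
    have hLpos : 0 < Fintype.card L := by
      rw [Fintype.card_pos_iff]
      by_contra h
      rw [not_nonempty_iff] at h
      simpa using (hab (f fun _ => false) trivial (g fun _ => false) trivial).1
    calc Real.log (Fintype.card L) ≤ Real.log (2 ^ C) :=
          Real.log_le_log (by exact_mod_cast hLpos) (by exact_mod_cast hcard)
      _ = C * Real.log 2 := Real.log_pow _ _
      _ ≤ C * 1 := mul_le_mul_of_nonneg_left (by linarith [Real.log_two_lt_d9]) (Nat.cast_nonneg C)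
      _ = C := mul_one _
  have hN : (0 : ℝ) < Fintype.card ι := by exact_mod_cast Fintype.card_pos
  have hsq : ∀ {κ : Type _} [Fintype κ] [Nonempty κ] (h : κ → ℝ),
      (𝔼 j, h j) ^ 2 ≤ 𝔼 j, h j ^ 2 := by
    intro κ _ _ h
    have hk : (0 : ℝ) < Fintype.card κ := by exact_mod_cast Fintype.card_pos
    have := sq_sum_le_card_mul_sum_sq (s := univ) (f := h)
    rw [Fintype.expect_eq_sum_div_card, Fintype.expect_eq_sum_div_card, div_pow, div_le_div_iff₀
      (by positivity) hk]
    rw [card_univ] at this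
    nlinarith
  calc (𝔼 d, 𝔼 i, G d i) ^ 2 * Fintype.card ι
      ≤ (𝔼 d, 𝔼 i, G d i ^ 2) * Fintype.card ι := by
        refine mul_le_mul_of_nonneg_right ?_ hN.le
        exact (hsq _).trans (expect_le_expect fun d _ => hsq _)
    _ = 𝔼 d, ∑ i, G d i ^ 2 := by
        rw [expect_mul]
        refine expect_congr rfl fun d _ => ?_
        rw [Fintype.expect_eq_sum_div_card]
        field_simp
    _ ≤ 64 * Real.log (Fintype.card L) := hmain
    _ ≤ 64 * C := by linarith

/-! ### Averaging over the coins -/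

/-- The easy direction of Yao's principle, by double counting: a protocol that succeeds with
probability `p` on every input is matched by a deterministic one in its support that is right on a
`p` fraction of any finite family. -/
theorem card_mul_le_of_forall_mem_support {α J : Type*} [Fintype J] (P : PMF α) (S : J → Set α)
    [∀ j, DecidablePred (· ∈ S j)] {p B : ℝ}
    (hS : ∀ j, ENNReal.ofReal p ≤ P.toOuterMeasure (S j))
    (hB : ∀ π ∈ P.support, ∑ j, (if π ∈ S j then (1 : ℝ) else 0) ≤ B) :
    Fintype.card J * p ≤ B := by
  have hB0 : 0 ≤ B := by
    obtain ⟨π, hπ⟩ := P.support_nonempty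
    exact (sum_nonneg fun j _ => by split_ifs <;> norm_num).trans (hB π hπ)
  rw [← ENNReal.ofReal_le_ofReal_iff hB0, ENNReal.ofReal_mul (Nat.cast_nonneg _),
    ENNReal.ofReal_natCast]
  calc (Fintype.card J : ℝ≥0∞) * ENNReal.ofReal p = ∑ _j : J, ENNReal.ofReal p := by simp
    _ ≤ ∑ j, P.toOuterMeasure (S j) := sum_le_sum fun j _ => hS j
    _ = ∑' π, ∑ j, (S j).indicator P π := by
        simp only [PMF.toOuterMeasure_apply]
        rw [Summable.tsum_finsetSum fun j _ => ENNReal.summable]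
    _ ≤ ∑' π, P π * ENNReal.ofReal B := by
        refine ENNReal.tsum_le_tsum fun π => ?_
        by_cases hπ : π ∈ P.support
        · have e : ∑ j, (S j).indicator P π =
              P π * ENNReal.ofReal (∑ j, if π ∈ S j then (1 : ℝ) else 0) := by
            rw [ENNReal.ofReal_sum_of_nonneg fun j _ => by split_ifs <;> norm_num, mul_sum]
            refine sum_congr rfl fun j _ => ?_
            by_cases h : π ∈ S j <;> simp [h]
          rw [e]
          gcongr
          exact hB π hπ
        · rw [PMF.mem_support_iff, not_not] at hπ
          simp [Set.indicator_apply, hπ]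
    _ = ENNReal.ofReal B := by rw [ENNReal.tsum_mul_right, P.tsum_coe, one_mul]

/-- Lower bound for every search problem whose solutions tell disjoint sets from sets that
intersect in a single point. -/
theorem RandProtocol.le_of_computes {X Y Z ι : Type*} [Fintype ι] [DecidableEq ι] [Nonempty ι]
    {R : X → Y → Z → Prop} {p : ℝ} (hp : 1 / 2 < p) {P : RandProtocol X Y Z} (hP : P.Computes R p)
    (T : Set Z) (f : (ι → Bool) → X) (g : (ι → Bool) → Y)
    (hdisj : ∀ x y, (∀ i, ¬ (x i = true ∧ y i = true)) → ∀ z, R (f x) (g y) z → z ∈ T)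
    (hmeet : ∀ x y, (∃ i, x i = true ∧ y i = true) → ∀ z, R (f x) (g y) z → z ∉ T)
    (C : ℕ) (hC : ∀ π ∈ P.support, ∀ x y, π.bits x y ≤ C) :
    (2 * p - 1) ^ 2 * Fintype.card ι ≤ 64 * C := by
  classical
  by_contra! hlt
  let J := (ι → Bool) × ι × (ι → Bool)
  let x : Bool → J → X := fun c j => f (update (j.1 ⊓ j.2.2) j.2.1 c)
  let y : Bool → J → Y := fun c j => g (update (j.1ᶜ ⊓ j.2.2) j.2.1 c)
  let K : ℝ := Fintype.card J
  have hK : 0 < K := Nat.cast_pos.2 Fintype.card_pos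
  have hN : (0 : ℝ) < Fintype.card ι := by exact_mod_cast Fintype.card_pos
  let δ : ℝ := √(64 * C / Fintype.card ι)
  have hδ : δ < 2 * p - 1 := by
    rw [Real.sqrt_lt' (by linarith), div_lt_iff₀ hN]
    exact hlt
  -- The hard family: `false` marks disjoint pairs, `true` pairs meeting only at `i`. A
  -- deterministic protocol that is right on both must change its membership in `T`, so its
  -- successes number at most `K` plus `K` times its advantage.
  have hcount := card_mul_le_of_forall_mem_support (J := Bool × J) P
    (fun j => {π | R (x j.1 j.2) (y j.1 j.2) (π.run (x j.1 j.2) (y j.1 j.2))})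
    (p := p) (B := K * (1 + δ)) (fun j => hP _ _) ?_
  · rw [Fintype.card_prod, Fintype.card_bool] at hcount
    push_cast at hcount
    change 2 * K * p ≤ _ at hcount
    nlinarith
  intro π hπ
  have hadv := π.sq_expect_advantage_le T f g C (hC π hπ)
  set D := 𝔼 d : ι → Bool, 𝔼 i : ι, 𝔼 z : ι → Bool,
      ((if π.run (f (update (d ⊓ z) i false)) (g (update (dᶜ ⊓ z) i false)) ∈ T
          then (1 : ℝ) else 0) -
        if π.run (f (update (d ⊓ z) i true)) (g (update (dᶜ ⊓ z) i true)) ∈ T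
          then 1 else 0) with hD
  have hDδ : D ≤ δ := by
    refine Real.le_sqrt_of_sq_le ?_
    rwa [le_div_iff₀ hN]
  have hDJ : D = 𝔼 j : J, ((if π.run (x false j) (y false j) ∈ T then (1 : ℝ) else 0) -
      if π.run (x true j) (y true j) ∈ T then 1 else 0) := by
    rw [← univ_product_univ, expect_product, ← univ_product_univ]
    refine expect_congr rfl fun d _ => ?_
    rw [expect_product]
  rw [Fintype.expect_eq_sum_div_card, eq_div_iff hK.ne', sum_sub_distrib] at hDJ
  rw [Fintype.sum_prod_type, Fintype.sum_bool]
  have ht : ∑ j : J, (if π ∈ {π | R (x true j) (y true j) (π.run (x true j) (y true j))}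
      then (1 : ℝ) else 0) ≤
      ∑ j : J, (1 - if π.run (x true j) (y true j) ∈ T then (1 : ℝ) else 0) := by
    refine sum_le_sum fun j _ => ?_
    by_cases h : R (x true j) (y true j) (π.run (x true j) (y true j))
    · have := hmeet _ _ ⟨j.2.1, by simp, by simp⟩ _ h
      rw [if_neg this]
      split_ifs <;> norm_num
    · simp only [Set.mem_ofPred_eq, h, if_false]
      split_ifs <;> norm_num
  have hf : ∑ j : J, (if π ∈ {π | R (x false j) (y false j) (π.run (x false j) (y false j))}
      then (1 : ℝ) else 0) ≤
      ∑ j : J, (if π.run (x false j) (y false j) ∈ T then (1 : ℝ) else 0) := by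
    refine sum_le_sum fun j _ => ?_
    by_cases h : R (x false j) (y false j) (π.run (x false j) (y false j))
    · have := hdisj _ _ (fun i => ?_) _ h
      · rw [if_pos this]
        split_ifs <;> norm_num
      · by_cases hi : i = j.2.1
        · subst hi; simp
        · simp only [update_of_ne hi, Pi.inf_apply, Pi.compl_apply]
          cases j.1 i <;> simp
    · simp only [Set.mem_ofPred_eq, h, if_false]
      split_ifs <;> norm_num
  rw [sum_sub_distrib, sum_const, card_univ, nsmul_eq_mul, mul_one] at ht
  change _ ≤ K - _ at ht
  change D * K = _ at hDJ
  nlinarith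

/-! ### The reduction from disjointness -/

/-- The preference list with the members of `S` first, then `a`, then everybody else. -/
def PrefList.favoring {A : Type*} [LinearOrder A] (S : A → Prop) [DecidablePred S] (a : A) :
    PrefList A where
  prefers b c := toLex ((if S b then 0 else if b = a then 1 else 2 : ℕ), b) <
    toLex ((if S c then 0 else if c = a then 1 else 2 : ℕ), c)
  isStrictTotalOrder :=
    RelEmbedding.isStrictTotalOrder (s := ((· < ·) : ℕ ×ₗ A → ℕ ×ₗ A → Prop))
      ⟨⟨fun b => toLex ((if S b then 0 else if b = a then 1 else 2 : ℕ), b),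
        fun _ _ h => (Prod.ext_iff.1 (toLex.injective h)).2⟩, Iff.rfl⟩

theorem PrefList.favoring_prefers_self {A : Type*} [LinearOrder A] {S : A → Prop}
    [DecidablePred S] {a b : A} (hb : ¬ S b) (hba : b ≠ a) :
    (PrefList.favoring S a).prefers a b := by
  simp only [PrefList.favoring, Prod.Lex.toLex_lt_toLex]
  left
  simp only [hb, hba, if_false, if_true]
  split_ifs <;> norm_num

theorem PrefList.favoring_prefers_iff {A : Type*} [LinearOrder A] {S : A → Prop}
    [DecidablePred S] {a b : A} (ha : ¬ S a) :
    (PrefList.favoring S a).prefers b a ↔ S b := by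
  simp only [PrefList.favoring, Prod.Lex.toLex_lt_toLex, ha, if_false, if_true]
  by_cases hb : S b
  · simp [hb]
  · by_cases hba : b = a
    · simp [hba, ha]
    · simp [hb, hba]

section Reduction

variable {A : Type*} [LinearOrder A] (X Y : A → A → Prop) [∀ a, DecidablePred (X a)]
  [∀ b, DecidablePred fun a => Y a b]

/-- Woman `a` ranks the men `b` with `X a b` first, then man `a`. -/
def womenProfile : Profile A A := fun a => PrefList.favoring (X a) a

/-- Man `b` ranks the women `a` with `Y a b` first, then woman `b`. -/
def menProfile : Profile A A := fun b => PrefList.favoring (fun a => Y a b) b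

variable {X Y}

theorem eq_refl_of_isStable {I : A → Prop} (hX : ∀ a b, X a b → I a ∧ ¬ I b)
    (hY : ∀ a b, Y a b → I a ∧ ¬ I b) (hXY : ∀ a b, ¬ (X a b ∧ Y a b)) {μ : PerfectMarriage A A}
    (h : IsStable (womenProfile X) (menProfile Y) μ) : μ = Equiv.refl A := by
  have hsymm : ∀ a, μ a ≠ a → μ.symm a ≠ a := fun a ha h' => ha (by
    conv_lhs => rw [← h']
    simp)
  -- Otherwise woman `a` and man `a` both prefer each other to their spouses.
  have hmain : ∀ a, μ a ≠ a → ¬ X a (μ a) → Y (μ.symm a) a := by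
    intro a ha hx
    by_contra hy
    exact h a a ⟨PrefList.favoring_prefers_self hx ha,
      PrefList.favoring_prefers_self (S := fun c => Y c a) hy (hsymm a ha)⟩
  -- For `b` outside `I`, woman `b` favors nobody, so man `b` has a favored wife in `I`. By
  -- disjointness she does not favor him, so her namesake must have a favored wife too, but men in
  -- `I` favor nobody.
  have hcol : ∀ b, ¬ I b → μ b = b := by
    intro b hb
    by_contra hne
    have h1 := hmain b hne fun hx => hb (hX _ _ hx).1
    have hI := (hY _ _ h1).1
    have h2 := hmain (μ.symm b) (by simpa using (hsymm b hne).symm)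
      (by simpa using fun hx => hXY _ _ ⟨hx, h1⟩)
    exact (hY _ _ h2).2 hI
  ext a
  change μ a = a
  by_contra hne
  have ha : I a := by
    by_contra ha
    exact hne (hcol a ha)
  have h1 := hmain a hne fun hx => hne (μ.injective (hcol _ (hX _ _ hx).2))
  exact (hY _ _ h1).2 ha

theorem not_isStable_refl {I : A → Prop} (hX : ∀ a b, X a b → I a ∧ ¬ I b)
    (hY : ∀ a b, Y a b → I a ∧ ¬ I b) (hXY : ∃ a b, X a b ∧ Y a b) :
    ¬ IsStable (womenProfile X) (menProfile Y) (Equiv.refl A) := by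
  obtain ⟨a, b, hx, hy⟩ := hXY
  intro h
  refine h a b ⟨(PrefList.favoring_prefers_iff ?_).2 hx,
    (PrefList.favoring_prefers_iff (S := fun c => Y c b) ?_).2 hy⟩
  · exact fun h' => (hX _ _ h').2 (hX _ _ h').1
  · exact fun h' => (hY _ _ h').2 (hY _ _ h').1

end Reduction

/-- A relation given by its bits on the pairs `(a, b)` with `I a` and `¬ I b`. -/
def bipartiteRel {A : Type*} (I : A → Prop) (x : {a // I a} × {b // ¬ I b} → Bool) (a b : A) :
    Prop :=
  ∃ (ha : I a) (hb : ¬ I b), x (⟨a, ha⟩, ⟨b, hb⟩) = true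

theorem bipartiteRel_mem {A : Type*} {I : A → Prop} {x : {a // I a} × {b // ¬ I b} → Bool}
    {a b : A} (h : bipartiteRel I x a b) : I a ∧ ¬ I b :=
  let ⟨ha, hb, _⟩ := h
  ⟨ha, hb⟩

theorem RandProtocol.le_of_computes_isStable {A : Type*} [LinearOrder A] [Fintype A]
    (I : A → Prop) [DecidablePred I] [Nonempty ({a // I a} × {b // ¬ I b})] {p : ℝ}
    (hp : 1 / 2 < p)
    {P : RandProtocol (Profile A A) (Profile A A) (PerfectMarriage A A)}
    (hP : P.Computes (fun PW PM μ => IsStable PW PM μ) p) (C : ℕ)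
    (hC : ∀ π ∈ P.support, ∀ x y, π.bits x y ≤ C) :
    (2 * p - 1) ^ 2 * (Fintype.card {a // I a} * Fintype.card {b // ¬ I b} : ℕ) ≤ 64 * C := by
  classical
  have h := RandProtocol.le_of_computes (ι := {a // I a} × {b // ¬ I b}) hp hP
    {Equiv.refl A} (fun x => womenProfile (bipartiteRel I x))
    (fun y => menProfile (bipartiteRel I y)) ?_ ?_ C hC
  · rwa [Fintype.card_prod] at h
  · intro x y hxy μ hμ
    refine eq_refl_of_isStable (fun _ _ => bipartiteRel_mem) (fun _ _ => bipartiteRel_mem) ?_ hμ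
    rintro a b ⟨⟨ha, hb, hx⟩, ⟨_, _, hy⟩⟩
    exact hxy (⟨a, ha⟩, ⟨b, hb⟩) ⟨hx, hy⟩
  · rintro x y ⟨⟨⟨a, ha⟩, ⟨b, hb⟩⟩, hx, hy⟩ μ hμ rfl
    exact not_isStable_refl (fun _ _ => bipartiteRel_mem) (fun _ _ => bipartiteRel_mem)
      ⟨a, b, ⟨ha, hb, hx⟩, ⟨ha, hb, hy⟩⟩ hμ

theorem mul_sq_le_of_computes_isStable {p : ℝ} (hp : 1 / 2 < p) {n : ℕ} (hn : 2 ≤ n)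
    {P : RandProtocol (Profile (Fin n) (Fin n)) (Profile (Fin n) (Fin n))
      (PerfectMarriage (Fin n) (Fin n))}
    (hP : P.Computes (fun PW PM μ => IsStable PW PM μ) p) (C : ℕ)
    (hC : ∀ π ∈ P.support, ∀ x y, π.bits x y ≤ C) :
    (2 * p - 1) ^ 2 / 512 * (n : ℝ) ^ 2 ≤ C := by
  let I : Fin n → Prop := fun a => (a : ℕ) < n / 2
  have hI : Fintype.card {a // I a} = n / 2 := by
    rw [Fintype.card_subtype]
    have := Fin.card_filter_val_lt (n := n) (m := n / 2)
    simp only [I]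
    omega
  have hI' : Fintype.card {a // ¬ I a} = n - n / 2 := by
    rw [Fintype.card_subtype_compl, hI, Fintype.card_fin]
  have : Nonempty {a // I a} := Fintype.card_pos_iff.1 (by omega)
  have : Nonempty {a // ¬ I a} := Fintype.card_pos_iff.1 (by omega)
  have h := RandProtocol.le_of_computes_isStable I hp hP C hC
  rw [hI, hI'] at h
  -- The factor 8 instead of 4 absorbs the rounding for odd `n`; with the 64 of the disjointness
  -- bound it gives 512.
  have hcard : n ^ 2 ≤ 8 * (n / 2 * (n - n / 2)) := by
    obtain ⟨k, hk | hk⟩ := Nat.even_or_odd' n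
    · have h1 : n / 2 = k := by omega
      have h2 : n - k = k := by omega
      rw [h1, h2, hk]
      nlinarith
    · have h1 : n / 2 = k := by omega
      have h2 : n - k = k + 1 := by omega
      have h3 : 1 ≤ k := by omega
      rw [h1, h2, hk]
      nlinarith
  have hcard' : (n : ℝ) ^ 2 ≤ 8 * ((n / 2 * (n - n / 2) : ℕ) : ℝ) := by exact_mod_cast hcard
  nlinarith [mul_le_mul_of_nonneg_left hcard' (sq_nonneg (2 * p - 1))]

end StableMarriage

theorem corollary3 (p : ℝ) (hp : 1 / 2 < p) (hp1 : p ≤ 1) :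
    ∃ c : ℝ, 0 < c ∧ ∃ N : ℕ, ∀ n : ℕ, N ≤ n →
      ENNReal.ofReal (c * (n : ℝ) ^ 2) ≤ (StableMarriage.stableMarriageCC p n : ℝ≥0∞) := by
  have hpos : 0 < 2 * p - 1 := by linarith
  refine ⟨(2 * p - 1) ^ 2 / 512, by positivity, 2, fun n hn => ?_⟩
  -- The cost lives in `ℕ∞`, so the real bound is first rounded up to a natural number.
  have key : ((⌈(2 * p - 1) ^ 2 / 512 * (n : ℝ) ^ 2⌉₊ : ℕ) : ℕ∞) ≤
      StableMarriage.stableMarriageCC p n := by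
    refine le_iInf₂ fun P hP => ?_
    cases hc : P.cost with
    | top => exact le_top
    | coe C =>
      refine Nat.cast_le.2 (Nat.ceil_le.2
        (StableMarriage.mul_sq_le_of_computes_isStable hp hn hP C fun π hπ x y => ?_))
      have h : ((π.bits x y : ℕ) : ℕ∞) ≤ P.cost :=
        le_iSup₂_of_le π hπ (le_iSup₂_of_le x y le_rfl)
      rw [hc] at h
      exact_mod_cast h
  calc ENNReal.ofReal ((2 * p - 1) ^ 2 / 512 * (n : ℝ) ^ 2)
      ≤ ENNReal.ofReal (⌈(2 * p - 1) ^ 2 / 512 * (n : ℝ) ^ 2⌉₊ : ℕ) :=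
        ENNReal.ofReal_le_ofReal (Nat.le_ceil _)
    _ = (((⌈(2 * p - 1) ^ 2 / 512 * (n : ℝ) ^ 2⌉₊ : ℕ) : ℕ∞) : ℝ≥0∞) := by
        rw [ENNReal.ofReal_natCast]; rfl
    _ ≤ _ := ENat.toENNReal_le.2 key
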